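/- **Language.** Let $\mathcal L$ be a first-order language with variables $v_0,v_1,\dots$ and a distinguished unary predicate $E$. Formulas are built from $\top$, $\bot$ and atomic formulas by the primitive connectives $\land,\lor,\to,\neg$ and the quantifiers $\forall,\exists$; write ${\sim}A$ for $A\to\bot$. The *global negative* formulas ($\mathrm{GN}$) are given by $N::=\bot\mid\neg A\mid N\land N\mid N\lor N\mid N\to N\mid\forall xN\mid\exists xN$, where $A$ is any formula and in the last two clauses $x$ must occur free in $N$. A free occurrence of $x$ in $A$ is *global* if it lies in a $\mathrm{GN}$ subformula of $A$. The variable $x$ *occurs only globally* in $A$ if it occurs free in $A$ and all its free occurrences are global; the formula $\exists xA$ is then called global, and otherwise (in particular if $x$ does not occur free in $A$) local. Let $\mathrm{ST}$ be given by $S::=\top\mid N\mid S\land S\mid S\lor N\mid N\lor S\mid A\to B\mid\forall xA$ ($N\in\mathrm{GN}$, $A,B$ any formulas), and $\mathrm{ST_P}$ by $S'::=S\mid S'\lor S'\mid\exists xS'$, where $S\in\mathrm{ST}$ and $\exists xS'$ is global. **The system $\mathbf{NSF_P}$** is the natural deduction system with the usual introduction and elimination rules for $\land$ and $\lor$, the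 introduction rule of $\top$, the rule that $\bot$ yields every formula, and the following rules: * $P(t_1,\dots,t_n)\,/\,E(t_i)$ for every predicate $P$, and $E(f(t_1,\dots,t_n))\,/\,E(t_i)$ for every function symbol $f$; * ${\sim}{\sim}S\,/\,S$ for $S\in\mathrm{ST_P}$; * from a derivation of ${\sim}{\sim}B$ from $A$ infer $A\to B$, discharging $A$; from $A\to B$ and $A$ infer ${\sim}{\sim}B$; * ${\sim}A\,/\,\neg A$; from $\neg A$ and $A$ infer $\bot$; * axioms $\neg\neg A\to A$ and $\forall x\,\neg\neg E(x)$; * ${\sim}{\sim}A\,/\,\forall xA$, where $x$ is not free in the open hypotheses; $\forall xA\,/\,{\sim}{\sim}A[t/x]$, where $t$ is free for $x$ in $A$; * $\exists$-introduction, for $t$ free for $x$ in $A$: from $A[t/x]$ infer $\exists xA$ if $\exists xA$ is global; from $A[t/x]$ and $E(t)$ infer $\exists xA$ if $\exists xA$ is local; * $\exists$-elimination: from $\exists yA$ and a derivation of $C$ infer $C$, discharging in that derivation the hypothesis $A[x/y]$ if $\exists yA$ is global, and the hypotheses $A[x/y]$ and $E(x)$ if $\exists yA$ is local; here $x$ is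 free for $y$ in $A$, is not free in $\exists yA$, in $C$, or in the other open hypotheses of the derivation of $C$. Let $\mathbf{SFQ_P}$ be the set of closed theorems of $\mathbf{NSF_P}$ and $\mathbf{SFQ_P^{-\neg}}$ the set of those in which $\neg$ does not occur. **The operation $\Psi$.** For a formula $A$ let $\Psi(A)$ be the set of all formulas obtained from $A$ by replacing one occurrence of a subformula of the form ${\sim}B$ by $\neg B$; for a set $X$ of formulas let $\Psi[X]=\bigcup_{A\in X}\Psi(A)$, $\Psi^0[X]=X$ and $\Psi^{n+1}[X]=\Psi[\Psi^n[X]]$. **Proposition.** $$\bigcup_{n=0}^{\infty}\Psi^n[\mathbf{SFQ_P^{-\neg}}]\subsetneq\mathbf{SFQ_P}.$$ Moreover, for every variable $x$ and every atomic formula $P(x)$ whose only variable is $x$: $\exists x(\neg P(x)\to\neg P(x))\in\mathbf{SFQ_P}$ and $\exists x({\sim}P(x)\to{\sim}P(x))\notin\mathbf{SFQ_P}$; and $\exists x(\neg P(x)\to\neg P(x))\notin\bigcup_{n=0}^{\infty}\Psi^n[\mathbf{SFQ_P^{-\neg}}]$. -/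

import Mathlib

universe u v

namespace SFQ

/-- Formulas over a first-order language `L` (terms are Mathlib's terms with variables `v_0, v_1, …`
indexed by `ℕ`, individual constants being the function symbols of arity `0`). All connectives,
including strict finitistic negation `neg`, are primitive. -/
inductive Fm (L : FirstOrder.Language.{u, v}) : Type (max u v)
  | top : Fm L
  | bot : Fm L
  | atom {n : ℕ} (R : L.Relations n) (ts : Fin n → L.Term ℕ) : Fm L
  | and (A B : Fm L) : Fm L
  | or (A B : Fm L) : Fm L
  | imp (A B : Fm L) : Fm L
  | neg (A : Fm L) : Fm L
  | all (x : ℕ) (A : Fm L) : Fm L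
  | ex (x : ℕ) (A : Fm L) : Fm L

variable {L : FirstOrder.Language.{u, v}}

namespace Fm

/-- Weak (intuitionistic) negation `⇁A`, the abbreviation of `A → ⊥`. -/
abbrev wneg (A : Fm L) : Fm L := imp A bot

/-- The set of free variables. -/
def fv : Fm L → Finset ℕ
  | top => ∅
  | bot => ∅
  | atom _ ts => Finset.univ.biUnion fun i => (ts i).varFinset
  | and A B => A.fv ∪ B.fv
  | or A B => A.fv ∪ B.fv
  | imp A B => A.fv ∪ B.fv
  | neg A => A.fv
  | all x A => A.fv.erase x
  | ex x A => A.fv.erase x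

/-- A formula is closed if it has no free variables. -/
def Closed (A : Fm L) : Prop := A.fv = ∅

/-- `A.subst x t` is `A[t/x]`: every free occurrence of `x` is replaced by `t`. -/
def subst (x : ℕ) (t : L.Term ℕ) : Fm L → Fm L
  | top => top
  | bot => bot
  | atom R ts => atom R fun i => (ts i).subst (Function.update FirstOrder.Language.Term.var x t)
  | and A B => and (A.subst x t) (B.subst x t)
  | or A B => or (A.subst x t) (B.subst x t)
  | imp A B => imp (A.subst x t) (B.subst x t)
  | neg A => neg (A.subst x t)
  | all y A => if y = x then all y A else all y (A.subst x t)
  | ex y A => if y = x then ex y A else ex y (A.subst x t)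

/-- `FreeFor t x A`: the term `t` is free for the variable `x` in `A`, i.e. no variable of `t`
becomes bound in `A[t/x]`. -/
def FreeFor (t : L.Term ℕ) (x : ℕ) : Fm L → Prop
  | top => True
  | bot => True
  | atom _ _ => True
  | and A B => FreeFor t x A ∧ FreeFor t x B
  | or A B => FreeFor t x A ∧ FreeFor t x B
  | imp A B => FreeFor t x A ∧ FreeFor t x B
  | neg A => FreeFor t x A
  | all y A => x ∉ (all y A).fv ∨ (y ∉ t.varFinset ∧ FreeFor t x A)
  | ex y A => x ∉ (ex y A).fv ∨ (y ∉ t.varFinset ∧ FreeFor t x A)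

/-- The global negative formulas. In the two quantifier clauses the quantified variable is
required to occur in the matrix: vacuous quantification is local, so a vacuously quantified formula
is not global. -/
inductive IsGN : Fm L → Prop
  | bot : IsGN bot
  | neg (A : Fm L) : IsGN (neg A)
  | and {M N : Fm L} : IsGN M → IsGN N → IsGN (and M N)
  | or {M N : Fm L} : IsGN M → IsGN N → IsGN (or M N)
  | imp {M N : Fm L} : IsGN M → IsGN N → IsGN (imp M N)
  | all {x : ℕ} {N : Fm L} : IsGN N → x ∈ N.fv → IsGN (all x N)
  | ex {x : ℕ} {N : Fm L} : IsGN N → x ∈ N.fv → IsGN (ex x N)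

/-- `OccursNonglobally x A`: some free occurrence of `x` in `A` lies in no global negative
subformula of `A`. -/
def OccursNonglobally (x : ℕ) : Fm L → Prop
  | top => False
  | bot => False
  | atom R ts => x ∈ (atom R ts).fv
  | and A B => ¬ IsGN (and A B) ∧ (OccursNonglobally x A ∨ OccursNonglobally x B)
  | or A B => ¬ IsGN (or A B) ∧ (OccursNonglobally x A ∨ OccursNonglobally x B)
  | imp A B => ¬ IsGN (imp A B) ∧ (OccursNonglobally x A ∨ OccursNonglobally x B)
  | neg A => ¬ IsGN (neg A) ∧ OccursNonglobally x A
  | all y A => ¬ IsGN (all y A) ∧ y ≠ x ∧ OccursNonglobally x A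
  | ex y A => ¬ IsGN (ex y A) ∧ y ≠ x ∧ OccursNonglobally x A

/-- `x` occurs free in `A`, and all its free occurrences are global. Quantification of `x` over `A`
is global if this holds, and local otherwise (in particular if it is vacuous). -/
def OnlyGlobal (x : ℕ) (A : Fm L) : Prop := x ∈ A.fv ∧ ¬ OccursNonglobally x A

/-- The class `ST` of stable formulas. -/
inductive IsST : Fm L → Prop
  | top : IsST top
  | gn {N : Fm L} : IsGN N → IsST N
  | and {S T : Fm L} : IsST S → IsST T → IsST (and S T)
  | or_left {S N : Fm L} : IsST S → IsGN N → IsST (or S N)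
  | or_right {N S : Fm L} : IsGN N → IsST S → IsST (or N S)
  | imp (A B : Fm L) : IsST (imp A B)
  | all (x : ℕ) (A : Fm L) : IsST (all x A)

/-- The class `ST_P`. -/
inductive IsSTP : Fm L → Prop
  | st {S : Fm L} : IsST S → IsSTP S
  | or {S T : Fm L} : IsSTP S → IsSTP T → IsSTP (or S T)
  | ex {x : ℕ} {S : Fm L} : IsSTP S → OnlyGlobal x S → IsSTP (ex x S)

/-- The formula does not contain strict finitistic negation `neg`. -/
def NegFree : Fm L → Prop
  | top => True
  | bot => True
  | atom _ _ => True
  | and A B => NegFree A ∧ NegFree B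
  | or A B => NegFree A ∧ NegFree B
  | imp A B => NegFree A ∧ NegFree B
  | neg _ => False
  | all _ A => NegFree A
  | ex _ A => NegFree A

end Fm

open Fm

/-- The atomic formula `E(t)`, for the distinguished existence predicate `E`. -/
def exists_ (E : L.Relations 1) (t : L.Term ℕ) : Fm L := Fm.atom E fun _ => t

/-- Derivability in the natural deduction system `NSF_P` with existence predicate `E`:
`NSFp E Γ A` says that there is a derivation of `A` all of whose open hypotheses are in `Γ`. -/
inductive NSFp (E : L.Relations 1) : Set (Fm L) → Fm L → Prop
  | hyp {Γ A} : A ∈ Γ → NSFp E Γ A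
  | weaken {Γ Δ A} : NSFp E Γ A → Γ ⊆ Δ → NSFp E Δ A
  | and_intro {Γ A B} : NSFp E Γ A → NSFp E Γ B → NSFp E Γ (and A B)
  | and_left {Γ A B} : NSFp E Γ (and A B) → NSFp E Γ A
  | and_right {Γ A B} : NSFp E Γ (and A B) → NSFp E Γ B
  | or_left {Γ A B} : NSFp E Γ A → NSFp E Γ (or A B)
  | or_right {Γ A B} : NSFp E Γ B → NSFp E Γ (or A B)
  | or_elim {Γ A B C} : NSFp E Γ (or A B) → NSFp E (insert A Γ) C → NSFp E (insert B Γ) C →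
      NSFp E Γ C
  | top_intro {Γ} : NSFp E Γ top
  | bot_elim {Γ A} : NSFp E Γ bot → NSFp E Γ A
  | str₁ {Γ} {n : ℕ} {R : L.Relations n} {ts : Fin n → L.Term ℕ} (i : Fin n) :
      NSFp E Γ (atom R ts) → NSFp E Γ (exists_ E (ts i))
  | str₂ {Γ} {n : ℕ} {f : L.Functions n} {ts : Fin n → L.Term ℕ} (i : Fin n) :
      NSFp E Γ (exists_ E (FirstOrder.Language.Term.func f ts)) → NSFp E Γ (exists_ E (ts i))
  | stp {Γ S} : IsSTP S → NSFp E Γ (wneg (wneg S)) → NSFp E Γ S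
  | imp_intro {Γ A B} : NSFp E (insert A Γ) (wneg (wneg B)) → NSFp E Γ (imp A B)
  | imp_elim {Γ A B} : NSFp E Γ (imp A B) → NSFp E Γ A → NSFp E Γ (wneg (wneg B))
  | neg_intro {Γ A} : NSFp E Γ (wneg A) → NSFp E Γ (neg A)
  | neg_elim {Γ A} : NSFp E Γ (neg A) → NSFp E Γ A → NSFp E Γ bot
  | dne {Γ} (A : Fm L) : NSFp E Γ (imp (neg (neg A)) A)
  | obj {Γ} (x : ℕ) : NSFp E Γ (all x (neg (neg (exists_ E (FirstOrder.Language.Term.var x)))))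
  | all_intro {Γ A} {x : ℕ} : NSFp E Γ (wneg (wneg A)) → (∀ B ∈ Γ, x ∉ B.fv) → NSFp E Γ (all x A)
  | all_elim {Γ A} {x : ℕ} {t : L.Term ℕ} : NSFp E Γ (all x A) → FreeFor t x A →
      NSFp E Γ (wneg (wneg (A.subst x t)))
  | ex_glo_intro {Γ A} {x : ℕ} {t : L.Term ℕ} : OnlyGlobal x A → FreeFor t x A →
      NSFp E Γ (A.subst x t) → NSFp E Γ (ex x A)
  | ex_loc_intro {Γ A} {x : ℕ} {t : L.Term ℕ} : ¬ OnlyGlobal x A → FreeFor t x A →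
      NSFp E Γ (A.subst x t) → NSFp E Γ (exists_ E t) → NSFp E Γ (ex x A)
  | ex_glo_elim {Γ Δ A C} {x y : ℕ} : OnlyGlobal y A → FreeFor (FirstOrder.Language.Term.var x) y A →
      (x = y ∨ x ∉ A.fv) → x ∉ C.fv → (∀ B ∈ Δ, x ∉ B.fv) →
      NSFp E Γ (ex y A) → NSFp E (insert (A.subst y (FirstOrder.Language.Term.var x)) Δ) C → NSFp E (Γ ∪ Δ) C
  | ex_loc_elim {Γ Δ A C} {x y : ℕ} : ¬ OnlyGlobal y A → FreeFor (FirstOrder.Language.Term.var x) y A →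
      (x = y ∨ x ∉ A.fv) → x ∉ C.fv → (∀ B ∈ Δ, x ∉ B.fv) →
      NSFp E Γ (ex y A) →
      NSFp E (insert (A.subst y (FirstOrder.Language.Term.var x))
        (insert (exists_ E (FirstOrder.Language.Term.var x)) Δ)) C → NSFp E (Γ ∪ Δ) C

/-- The set of the (closed) theorems of `NSF_P`. -/
def SFQp (E : L.Relations 1) : Set (Fm L) := {A | A.Closed ∧ NSFp E ∅ A}

/-- The set of the theorems of `NSF_P` in which `neg` does not occur. -/
def SFQpNegFree (E : L.Relations 1) : Set (Fm L) := {A | A ∈ SFQp E ∧ A.NegFree}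

/-- Formula contexts: formulas with exactly one placeholder `hole`. -/
inductive Cont (L : FirstOrder.Language.{u, v}) : Type (max u v)
  | hole : Cont L
  | andL (F : Cont L) (A : Fm L) : Cont L
  | andR (A : Fm L) (F : Cont L) : Cont L
  | orL (F : Cont L) (A : Fm L) : Cont L
  | orR (A : Fm L) (F : Cont L) : Cont L
  | impL (F : Cont L) (A : Fm L) : Cont L
  | impR (A : Fm L) (F : Cont L) : Cont L
  | neg (F : Cont L) : Cont L
  | all (x : ℕ) (F : Cont L) : Cont L
  | ex (x : ℕ) (F : Cont L) : Cont L

/-- `F.fill B` is `F[B]`; variables of `B` may become bound. -/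
def Cont.fill : Cont L → Fm L → Fm L
  | .hole, B => B
  | .andL F A, B => Fm.and (F.fill B) A
  | .andR A F, B => Fm.and A (F.fill B)
  | .orL F A, B => Fm.or (F.fill B) A
  | .orR A F, B => Fm.or A (F.fill B)
  | .impL F A, B => Fm.imp (F.fill B) A
  | .impR A F, B => Fm.imp A (F.fill B)
  | .neg F, B => Fm.neg (F.fill B)
  | .all x F, B => Fm.all x (F.fill B)
  | .ex x F, B => Fm.ex x (F.fill B)

/-- `Ψ(A)`: the results of replacing one occurrence of a subformula `⇁B` of `A` by `¬B`. -/
def Psi (A : Fm L) : Set (Fm L) :=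
  {C | ∃ (F : Cont L) (B : Fm L), A = F.fill (wneg B) ∧ C = F.fill (neg B)}

/-- `Ψ[X]`, the union of the `Ψ(A)` over `A ∈ X`. -/
def PsiImage (X : Set (Fm L)) : Set (Fm L) := ⋃ A ∈ X, Psi A

end SFQ

/-! The formulas `⇁B` and `¬B` are equivalent in `NSF_P`, but `¬B` is always global negative while
`⇁B` is so only if `B` is. Replacing `⇁` by `¬` can therefore turn a local quantifier into a global
one, never the reverse.

Inclusion: by induction on the context, `F[⇁B]` derives `F[¬B]`, and `F[¬B]` derives `⇁⇁F[⇁B]`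
(`Cont.nsfp_fill_neg`). The weak converse suffices in contravariant positions because the rules for
`→`, `¬` and `∀` work up to `⇁⇁`.

Strictness: writing every `¬` as `⇁` (`unneg`) is invariant under `Ψ` and fixes `¬`-free formulas,
so it sends every member of the union to a theorem. It sends `∃x(¬P → ¬P)` to `∃x(⇁P → ⇁P)`, where
the quantifier is local. A local existential needs an object that already exists, so it fails at the
root of a two-world model where nothing exists yet; soundness (`NSFp.forceRoot`) shows that it is no
theorem. -/

namespace SFQ

namespace Fm

section Formulas

variable {L : FirstOrder.Language.{u, v}}

/-! ### Global negative formulas, globality and substitution -/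

theorem isGN_and_iff {A B : Fm L} : IsGN (and A B) ↔ IsGN A ∧ IsGN B :=
  ⟨fun h => by cases h with | and h₁ h₂ => exact ⟨h₁, h₂⟩, fun h => .and h.1 h.2⟩

theorem isGN_or_iff {A B : Fm L} : IsGN (or A B) ↔ IsGN A ∧ IsGN B :=
  ⟨fun h => by cases h with | or h₁ h₂ => exact ⟨h₁, h₂⟩, fun h => .or h.1 h.2⟩

theorem isGN_imp_iff {A B : Fm L} : IsGN (imp A B) ↔ IsGN A ∧ IsGN B :=
  ⟨fun h => by cases h with | imp h₁ h₂ => exact ⟨h₁, h₂⟩, fun h => .imp h.1 h.2⟩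

theorem isGN_all_iff {A : Fm L} {x : ℕ} : IsGN (all x A) ↔ IsGN A ∧ x ∈ A.fv :=
  ⟨fun h => by cases h with | all h₁ h₂ => exact ⟨h₁, h₂⟩, fun h => .all h.1 h.2⟩

theorem isGN_ex_iff {A : Fm L} {x : ℕ} : IsGN (ex x A) ↔ IsGN A ∧ x ∈ A.fv :=
  ⟨fun h => by cases h with | ex h₁ h₂ => exact ⟨h₁, h₂⟩, fun h => .ex h.1 h.2⟩

theorem not_isGN_atom {n : ℕ} {R : L.Relations n} {ts : Fin n → L.Term ℕ} :
    ¬ IsGN (atom R ts) := by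
  intro h; cases h

theorem IsGN.not_occursNonglobally {A : Fm L} (h : IsGN A) (x : ℕ) :
    ¬ OccursNonglobally x A := by
  cases h <;> simp_all [OccursNonglobally, isGN_and_iff, isGN_or_iff, isGN_imp_iff,
    isGN_all_iff, isGN_ex_iff, IsGN.neg]

theorem term_subst_of_notMem {x : ℕ} {s : L.Term ℕ} (t : L.Term ℕ) (h : x ∉ s.varFinset) :
    s.subst (Function.update FirstOrder.Language.Term.var x t) = s := by
  induction s with
  | var y =>
    have : y ≠ x := by rintro rfl; simp [FirstOrder.Language.Term.varFinset] at h
    simp [FirstOrder.Language.Term.subst, this]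
  | func f ts ih =>
    simp only [FirstOrder.Language.Term.varFinset, Finset.mem_biUnion, not_exists, not_and] at h
    simp only [FirstOrder.Language.Term.subst]
    congr 1
    funext i
    exact ih i (h i (Finset.mem_univ i))

theorem mem_varFinset_term_subst {x z : ℕ} {s t : L.Term ℕ} (hzx : z ≠ x)
    (hzt : z ∉ t.varFinset) :
    z ∈ (s.subst (Function.update FirstOrder.Language.Term.var x t)).varFinset ↔
      z ∈ s.varFinset := by
  induction s with
  | var y =>
    by_cases hy : y = x
    · subst hy
      simp [FirstOrder.Language.Term.subst, FirstOrder.Language.Term.varFinset, hzx, hzt]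
    · simp [FirstOrder.Language.Term.subst, hy]
  | func f ts ih =>
    simp [FirstOrder.Language.Term.subst, FirstOrder.Language.Term.varFinset, ih]

theorem subst_of_notMem {x : ℕ} {A : Fm L} (t : L.Term ℕ) (h : x ∉ A.fv) :
    A.subst x t = A := by
  induction A with
  | top => rfl
  | bot => rfl
  | atom R ts =>
    simp only [fv, Finset.mem_biUnion, not_exists, not_and] at h
    simp only [subst]
    congr 1
    funext i
    exact term_subst_of_notMem t (h i (Finset.mem_univ i))
  | and A B ihA ihB | or A B ihA ihB | imp A B ihA ihB =>
    simp only [fv, Finset.mem_union, not_or] at h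
    simp [subst, ihA h.1, ihB h.2]
  | neg A ih => simp [subst, ih h]
  | all y A ih | ex y A ih =>
    by_cases hy : y = x
    · simp [subst, hy]
    · simp only [fv, Finset.mem_erase, not_and] at h
      simp [subst, ih (h (Ne.symm hy))]

theorem mem_fv_subst {x z : ℕ} {A : Fm L} {t : L.Term ℕ} (hzx : z ≠ x)
    (hzt : z ∉ t.varFinset) : z ∈ (A.subst x t).fv ↔ z ∈ A.fv := by
  induction A with
  | top => rfl
  | bot => rfl
  | atom R ts => simp [subst, fv, mem_varFinset_term_subst hzx hzt]
  | and A B ihA ihB | or A B ihA ihB | imp A B ihA ihB => simp [subst, fv, ihA, ihB]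
  | neg A ih => simpa [subst, fv] using ih
  | all y A ih | ex y A ih => by_cases hy : y = x <;> simp [subst, fv, hy, ih]

theorem term_subst_var (s : L.Term ℕ) : s.subst FirstOrder.Language.Term.var = s := by
  induction s with
  | var y => rfl
  | func f ts ih => simp [FirstOrder.Language.Term.subst, ih]

theorem subst_self (x : ℕ) (A : Fm L) : A.subst x (FirstOrder.Language.Term.var x) = A := by
  induction A with
  | top => rfl
  | bot => rfl
  | atom R ts =>
    simp only [subst, Function.update_eq_self]
    congr 1
    funext i
    exact term_subst_var (ts i)
  | and A B ihA ihB | or A B ihA ihB | imp A B ihA ihB => simp [subst, ihA, ihB]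
  | neg A ih => simp [subst, ih]
  | all y A ih | ex y A ih => simp [subst, ih]

theorem freeFor_self (x : ℕ) (A : Fm L) : FreeFor (FirstOrder.Language.Term.var x) x A := by
  induction A with
  | top => trivial
  | bot => trivial
  | atom R ts => trivial
  | and A B ihA ihB | or A B ihA ihB | imp A B ihA ihB => exact ⟨ihA, ihB⟩
  | neg A ih => exact ih
  | all y A ih | ex y A ih =>
    by_cases hy : y = x
    · left; simp [fv, hy]
    · right; exact ⟨by simpa [FirstOrder.Language.Term.varFinset] using hy, ih⟩

theorem all_subst_cases {x y : ℕ} {A : Fm L} {t : L.Term ℕ} (h : FreeFor t x (all y A)) :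
    (all y A).subst x t = all y A ∨
      y ≠ x ∧ y ∉ t.varFinset ∧ FreeFor t x A ∧ (all y A).subst x t = all y (A.subst x t) := by
  by_cases hy : y = x
  · left; simp [subst, hy]
  · rcases h with h | h
    · exact .inl (subst_of_notMem t h)
    · exact .inr ⟨hy, h.1, h.2, by simp [subst, hy]⟩

theorem ex_subst_cases {x y : ℕ} {A : Fm L} {t : L.Term ℕ} (h : FreeFor t x (ex y A)) :
    (ex y A).subst x t = ex y A ∨
      y ≠ x ∧ y ∉ t.varFinset ∧ FreeFor t x A ∧ (ex y A).subst x t = ex y (A.subst x t) := by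
  by_cases hy : y = x
  · left; simp [subst, hy]
  · rcases h with h | h
    · exact .inl (subst_of_notMem t h)
    · exact .inr ⟨hy, h.1, h.2, by simp [subst, hy]⟩

/-- Only the non-vacuity condition on quantifiers could be affected. Without `FreeFor`, capture
could turn a vacuous quantifier into a non-vacuous one. -/
theorem isGN_subst {x : ℕ} {A : Fm L} {t : L.Term ℕ} (h : FreeFor t x A) :
    IsGN (A.subst x t) ↔ IsGN A := by
  induction A with
  | top => rfl
  | bot => rfl
  | atom R ts => simp [subst, not_isGN_atom]
  | and A B ihA ihB => simp [subst, isGN_and_iff, ihA h.1, ihB h.2]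
  | or A B ihA ihB => simp [subst, isGN_or_iff, ihA h.1, ihB h.2]
  | imp A B ihA ihB => simp [subst, isGN_imp_iff, ihA h.1, ihB h.2]
  | neg A ih => simp [subst, IsGN.neg]
  | all y A ih =>
    rcases all_subst_cases h with e | ⟨hy, ht, hA, e⟩
    · rw [e]
    · rw [e, isGN_all_iff, isGN_all_iff, ih hA, mem_fv_subst hy ht]
  | ex y A ih =>
    rcases ex_subst_cases h with e | ⟨hy, ht, hA, e⟩
    · rw [e]
    · rw [e, isGN_ex_iff, isGN_ex_iff, ih hA, mem_fv_subst hy ht]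

theorem occursNonglobally_subst {x z : ℕ} {A : Fm L} {t : L.Term ℕ} (h : FreeFor t x A)
    (hzx : z ≠ x) (hzt : z ∉ t.varFinset) :
    OccursNonglobally z (A.subst x t) ↔ OccursNonglobally z A := by
  have hGN := isGN_subst h
  induction A with
  | top => rfl
  | bot => rfl
  | atom R ts => exact mem_fv_subst (A := atom R ts) hzx hzt
  | and A B ihA ihB | or A B ihA ihB | imp A B ihA ihB =>
    simp only [subst] at hGN ⊢
    simp only [OccursNonglobally, hGN, ihA h.1 (isGN_subst h.1), ihB h.2 (isGN_subst h.2)]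
  | neg A ih => simp [subst, OccursNonglobally, IsGN.neg]
  | all y A ih =>
    rcases all_subst_cases h with e | ⟨hy, ht, hA, e⟩
    · rw [e]
    · rw [e] at hGN ⊢
      simp only [OccursNonglobally, hGN, ih hA (isGN_subst hA)]
  | ex y A ih =>
    rcases ex_subst_cases h with e | ⟨hy, ht, hA, e⟩
    · rw [e]
    · rw [e] at hGN ⊢
      simp only [OccursNonglobally, hGN, ih hA (isGN_subst hA)]

theorem onlyGlobal_subst {x z : ℕ} {A : Fm L} {t : L.Term ℕ} (h : FreeFor t x A)
    (hzx : z ≠ x) (hzt : z ∉ t.varFinset) :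
    OnlyGlobal z (A.subst x t) ↔ OnlyGlobal z A := by
  rw [OnlyGlobal, OnlyGlobal, occursNonglobally_subst h hzx hzt, mem_fv_subst hzx hzt]

/-! ### A two-world model

The domain has one element. At the root no atomic formula holds, and at the final world all of
them do. -/

/-- Forcing at the final world. -/
def ForceTop : Fm L → Prop
  | top => True
  | bot => False
  | atom _ _ => True
  | and A B => ForceTop A ∧ ForceTop B
  | or A B => ForceTop A ∨ ForceTop B
  | imp A B => ForceTop A → ForceTop B
  | neg A => ¬ ForceTop A
  | all _ A => ForceTop A
  | ex _ A => ForceTop A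

/-- Forcing at the root. -/
def ForceRoot : Fm L → Prop
  | top => True
  | bot => False
  | atom _ _ => False
  | and A B => ForceRoot A ∧ ForceRoot B
  | or A B => ForceRoot A ∨ ForceRoot B
  | imp A B => ForceTop A → ForceTop B
  | neg A => ¬ ForceTop A
  | all _ A => ForceTop A
  | ex x A => OnlyGlobal x A ∧ ForceRoot A

theorem ForceRoot.forceTop {A : Fm L} (h : ForceRoot A) : ForceTop A := by
  induction A with
  | top => trivial
  | bot => exact h
  | atom R ts => trivial
  | and A B ihA ihB => exact ⟨ihA h.1, ihB h.2⟩
  | or A B ihA ihB => exact h.imp ihA ihB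
  | imp A B => exact h
  | neg A => exact h
  | all x A => exact h
  | ex x A ih => exact ih h.2

/-- Atoms, on which the two worlds disagree, occur only under `¬`, which looks at the final world
alone; an existential quantifier in a global negative formula is automatically global. -/
theorem IsGN.forceRoot {A : Fm L} (hA : IsGN A) (h : ForceTop A) : ForceRoot A := by
  induction hA with
  | bot => exact h
  | neg A => exact h
  | and _ _ ih₁ ih₂ => exact ⟨ih₁ h.1, ih₂ h.2⟩
  | or _ _ ih₁ ih₂ => exact Or.imp ih₁ ih₂ h
  | imp => exact h
  | all => exact h
  | ex hN hx ih => exact ⟨⟨hx, hN.not_occursNonglobally _⟩, ih h⟩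

theorem IsST.forceRoot {A : Fm L} (hA : IsST A) (h : ForceTop A) : ForceRoot A := by
  induction hA with
  | top => trivial
  | gn hN => exact hN.forceRoot h
  | and _ _ ih₁ ih₂ => exact ⟨ih₁ h.1, ih₂ h.2⟩
  | or_left _ hN ih => exact Or.imp ih hN.forceRoot h
  | or_right hN _ ih => exact Or.imp hN.forceRoot ih h
  | imp => exact h
  | all => exact h

/-- This is the soundness of `⇁⇁S / S` at the root, where `⇁⇁S` only says that `S` holds at the
final world. -/
theorem IsSTP.forceRoot {A : Fm L} (hA : IsSTP A) (h : ForceTop A) : ForceRoot A := by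
  induction hA with
  | st hS => exact hS.forceRoot h
  | or _ _ ih₁ ih₂ => exact Or.imp ih₁ ih₂ h
  | ex _ hx ih => exact ⟨hx, ih h⟩

theorem forceTop_subst {x : ℕ} {t : L.Term ℕ} {A : Fm L} :
    ForceTop (A.subst x t) ↔ ForceTop A := by
  induction A with
  | top => rfl
  | bot => rfl
  | atom R ts => rfl
  | and A B ihA ihB | or A B ihA ihB | imp A B ihA ihB => simp [subst, ForceTop, ihA, ihB]
  | neg A ih => simp [subst, ForceTop, ih]
  | all y A ih | ex y A ih => by_cases hy : y = x <;> simp [subst, ForceTop, hy, ih]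

/-- `FreeFor` matters here, unlike at the final world, because the clause for `∃` contains the
syntactic test `OnlyGlobal`. -/
theorem forceRoot_subst {x : ℕ} {t : L.Term ℕ} {A : Fm L} (h : FreeFor t x A) :
    ForceRoot (A.subst x t) ↔ ForceRoot A := by
  induction A with
  | top => rfl
  | bot => rfl
  | atom R ts => rfl
  | and A B ihA ihB | or A B ihA ihB => simp [subst, ForceRoot, ihA h.1, ihB h.2]
  | imp A B => simp [subst, ForceRoot, forceTop_subst]
  | neg A => simp [subst, ForceRoot, forceTop_subst]
  | all y A => by_cases hy : y = x <;> simp [subst, ForceRoot, hy, forceTop_subst]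
  | ex y A ih =>
    rcases ex_subst_cases h with e | ⟨hy, ht, hA, e⟩
    · rw [e]
    · rw [e]
      simp only [ForceRoot, ih hA, onlyGlobal_subst hA hy ht]

/-- Replacement of every `¬` by weak negation. -/
def unneg : Fm L → Fm L
  | top => top
  | bot => bot
  | atom R ts => atom R ts
  | and A B => and A.unneg B.unneg
  | or A B => or A.unneg B.unneg
  | imp A B => imp A.unneg B.unneg
  | neg A => wneg A.unneg
  | all x A => all x A.unneg
  | ex x A => ex x A.unneg

theorem NegFree.unneg_eq {A : Fm L} (h : A.NegFree) : A.unneg = A := by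
  induction A with
  | top => rfl
  | bot => rfl
  | atom R ts => rfl
  | and A B ihA ihB | or A B ihA ihB | imp A B ihA ihB => simp [unneg, ihA h.1, ihB h.2]
  | neg A => exact h.elim
  | all x A ih | ex x A ih => simp [unneg, ih h]

end Formulas

end Fm

section Derivations

open Fm

variable {L : FirstOrder.Language.{u, v}} {E : L.Relations 1}

/-! ### Soundness of the two-world model -/

theorem NSFp.forceTop {Γ : Set (Fm L)} {A : Fm L} (h : NSFp E Γ A) :
    (∀ B ∈ Γ, B.ForceTop) → A.ForceTop := by
  induction h with
  | hyp h => exact fun hΓ => hΓ _ h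
  | weaken _ hs ih => exact fun hΓ => ih fun B hB => hΓ B (hs hB)
  | and_intro _ _ ih₁ ih₂ => exact fun hΓ => ⟨ih₁ hΓ, ih₂ hΓ⟩
  | and_left _ ih => exact fun hΓ => (ih hΓ).1
  | and_right _ ih => exact fun hΓ => (ih hΓ).2
  | or_left _ ih => exact fun hΓ => .inl (ih hΓ)
  | or_right _ ih => exact fun hΓ => .inr (ih hΓ)
  | or_elim _ _ _ ih ih₁ ih₂ =>
    intro hΓ
    rcases ih hΓ with h | h
    · exact ih₁ (Set.forall_mem_insert.2 ⟨h, hΓ⟩)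
    · exact ih₂ (Set.forall_mem_insert.2 ⟨h, hΓ⟩)
  | top_intro => exact fun _ => trivial
  | bot_elim _ ih => exact fun hΓ => (ih hΓ).elim
  | str₁ => exact fun _ => trivial
  | str₂ => exact fun _ => trivial
  | stp _ _ ih => exact fun hΓ => by_contra (ih hΓ)
  | imp_intro _ ih =>
    exact fun hΓ h => by_contra (ih (Set.forall_mem_insert.2 ⟨h, hΓ⟩))
  | imp_elim _ _ ih₁ ih₂ => exact fun hΓ h => h (ih₁ hΓ (ih₂ hΓ))
  | neg_intro _ ih => exact ih
  | neg_elim _ _ ih₁ ih₂ => exact fun hΓ => ih₁ hΓ (ih₂ hΓ)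
  | dne A => exact fun _ h => by_contra h
  | obj x => exact fun _ h => h trivial
  | all_intro _ _ ih => exact fun hΓ => by_contra (ih hΓ)
  | all_elim _ _ ih => exact fun hΓ h => h (forceTop_subst.2 (ih hΓ))
  | ex_glo_intro _ _ _ ih => exact fun hΓ => have h := forceTop_subst.1 (ih hΓ); h
  | ex_loc_intro _ _ _ _ ih => exact fun hΓ => have h := forceTop_subst.1 (ih hΓ); h
  | ex_glo_elim _ _ _ _ _ _ _ ih₁ ih₂ =>
    intro hΓ
    refine ih₂ (Set.forall_mem_insert.2 ⟨forceTop_subst.2 (ih₁ fun B hB => hΓ B (.inl hB)), ?_⟩)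
    exact fun B hB => hΓ B (.inr hB)
  | ex_loc_elim _ _ _ _ _ _ _ ih₁ ih₂ =>
    intro hΓ
    refine ih₂ (Set.forall_mem_insert.2 ⟨forceTop_subst.2 (ih₁ fun B hB => hΓ B (.inl hB)), ?_⟩)
    exact Set.forall_mem_insert.2 ⟨trivial, fun B hB => hΓ B (.inr hB)⟩

theorem NSFp.forceRoot {Γ : Set (Fm L)} {A : Fm L} (h : NSFp E Γ A) :
    (∀ B ∈ Γ, B.ForceRoot) → A.ForceRoot := by
  -- At the root, `→`, `¬`, `∀` and `⊥` are evaluated as at the final world, so rules with such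
  -- conclusions reduce to soundness there.
  have top_of : ∀ {Γ : Set (Fm L)} {A : Fm L}, NSFp E Γ A → (∀ B ∈ Γ, B.ForceRoot) →
      A.ForceTop := fun h hΓ => h.forceTop fun B hB => (hΓ B hB).forceTop
  induction h with
  | hyp h => exact fun hΓ => hΓ _ h
  | weaken _ hs ih => exact fun hΓ => ih fun B hB => hΓ B (hs hB)
  | and_intro _ _ ih₁ ih₂ => exact fun hΓ => ⟨ih₁ hΓ, ih₂ hΓ⟩
  | and_left _ ih => exact fun hΓ => (ih hΓ).1
  | and_right _ ih => exact fun hΓ => (ih hΓ).2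
  | or_left _ ih => exact fun hΓ => .inl (ih hΓ)
  | or_right _ ih => exact fun hΓ => .inr (ih hΓ)
  | or_elim _ _ _ ih ih₁ ih₂ =>
    intro hΓ
    rcases ih hΓ with h | h
    · exact ih₁ (Set.forall_mem_insert.2 ⟨h, hΓ⟩)
    · exact ih₂ (Set.forall_mem_insert.2 ⟨h, hΓ⟩)
  | top_intro => exact fun _ => trivial
  | bot_elim _ ih => exact fun hΓ => (ih hΓ).elim
  | str₁ _ _ ih => exact fun hΓ => (ih hΓ).elim
  | str₂ _ _ ih => exact fun hΓ => (ih hΓ).elim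
  | stp hS h => exact fun hΓ => hS.forceRoot (by_contra (top_of h hΓ))
  | imp_intro h =>
    exact fun hΓ => (NSFp.imp_intro h).forceTop fun B hB => (hΓ B hB).forceTop
  | imp_elim h₁ h₂ => exact fun hΓ => top_of (.imp_elim h₁ h₂) hΓ
  | neg_intro h => exact fun hΓ => top_of h hΓ
  | neg_elim h₁ h₂ => exact fun hΓ => top_of (.neg_elim h₁ h₂) hΓ
  | dne A => exact fun _ h => by_contra h
  | obj x => exact fun _ h => h trivial
  | all_intro h _ => exact fun hΓ => by_contra (top_of h hΓ)
  | all_elim h hF => exact fun hΓ => top_of (.all_elim h hF) hΓ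
  | ex_glo_intro hg hF _ ih => exact fun hΓ => ⟨hg, (forceRoot_subst hF).1 (ih hΓ)⟩
  -- The premise `E(t)` is never forced at the root.
  | ex_loc_intro _ _ _ _ _ ih => exact fun hΓ => (ih hΓ).elim
  | ex_glo_elim _ hF _ _ _ _ _ ih₁ ih₂ =>
    intro hΓ
    refine ih₂ (Set.forall_mem_insert.2
      ⟨(forceRoot_subst hF).2 (ih₁ fun B hB => hΓ B (.inl hB)).2, ?_⟩)
    exact fun B hB => hΓ B (.inr hB)
  | ex_loc_elim hl _ _ _ _ _ _ ih₁ _ =>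
    exact fun hΓ => (hl (ih₁ fun B hB => hΓ B (.inl hB)).1).elim

/-! ### Derived rules: reasoning under double weak negation -/

namespace NSFp

variable {Γ : Set (Fm L)} {A B C : Fm L}

/-- Elimination of `A ∨ A` serves as cut, since detachment through `→` would yield only `⇁⇁B`. -/
theorem cut (h₁ : NSFp E Γ A) (h₂ : NSFp E (insert A Γ) B) : NSFp E Γ B :=
  .or_elim (.or_left (B := A) h₁) h₂ h₂

theorem head : NSFp E (insert A Γ) A := .hyp (Set.mem_insert _ _)

theorem tail (h : NSFp E Γ A) : NSFp E (insert B Γ) A := .weaken h (Set.subset_insert _ _)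

theorem of_singleton (h : NSFp E {A} B) (hA : NSFp E Γ A) : NSFp E Γ B :=
  cut hA (.weaken h (by simp))

/-- Detachment gives `⇁⇁⊥`, and `⊥` is stable. -/
theorem wneg_elim (h₁ : NSFp E Γ (wneg A)) (h₂ : NSFp E Γ A) : NSFp E Γ bot :=
  .stp (.st (.gn .bot)) (.imp_elim h₁ h₂)

theorem wneg_wneg_intro (h : NSFp E Γ A) : NSFp E Γ (wneg (wneg A)) :=
  .imp_intro (.imp_elim head h.tail)

theorem wneg_intro (h : NSFp E (insert A Γ) bot) : NSFp E Γ (wneg A) :=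
  .imp_intro h.wneg_wneg_intro

theorem wneg_wneg_bind (h₁ : NSFp E Γ (wneg (wneg A)))
    (h₂ : NSFp E (insert A Γ) (wneg (wneg B))) : NSFp E Γ (wneg (wneg B)) :=
  wneg_intro <| wneg_elim h₁.tail <| wneg_intro <|
    wneg_elim (.weaken h₂ (Set.insert_subset_insert (Set.subset_insert _ _))) (tail head)

theorem wneg_wneg_mp (h₁ : NSFp E Γ (wneg (wneg A))) (h₂ : NSFp E {A} (wneg (wneg B))) :
    NSFp E Γ (wneg (wneg B)) :=
  wneg_wneg_bind h₁ (of_singleton h₂ head)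

theorem neg_congr (h : NSFp E {B} (wneg (wneg A))) : NSFp E {neg A} (neg B) :=
  .neg_intro <| wneg_intro <| wneg_elim (of_singleton h head) <|
    wneg_intro <| .neg_elim (tail (tail (.hyp rfl))) head

theorem imp_congr {A' B' : Fm L} (hA : NSFp E {A'} (wneg (wneg A)))
    (hB : NSFp E {B} (wneg (wneg B'))) : NSFp E {imp A B} (imp A' B') :=
  .imp_intro <| wneg_wneg_bind (of_singleton hA head) <|
    wneg_wneg_mp (.imp_elim (tail (tail (.hyp rfl))) head) hB

theorem all_congr {x : ℕ} (h : NSFp E {A} (wneg (wneg B))) : NSFp E {all x A} (all x B) := by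
  refine .all_intro (wneg_wneg_mp ?_ h) (by simp [fv])
  have := all_elim (E := E) (Γ := {all x A}) (.hyp rfl) (freeFor_self x A)
  rwa [subst_self] at this

theorem and_congr {A' B' : Fm L} (hA : NSFp E {A} A') (hB : NSFp E {B} B') :
    NSFp E {and A B} (and A' B') :=
  .and_intro (of_singleton hA (.and_left (.hyp rfl))) (of_singleton hB (.and_right (.hyp rfl)))

theorem or_congr {A' B' : Fm L} (hA : NSFp E {A} A') (hB : NSFp E {B} B') :
    NSFp E {or A B} (or A' B') :=
  .or_elim (.hyp rfl) (.or_left (of_singleton hA head)) (.or_right (of_singleton hB head))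

theorem wneg_wneg_and (hA : NSFp E Γ (wneg (wneg A))) (hB : NSFp E Γ (wneg (wneg B))) :
    NSFp E Γ (wneg (wneg (and A B))) :=
  wneg_wneg_bind hA <| wneg_wneg_bind hB.tail <| wneg_wneg_intro <|
    .and_intro (tail head) head

theorem wneg_wneg_or_left (hA : NSFp E Γ (wneg (wneg A))) :
    NSFp E Γ (wneg (wneg (or A B))) :=
  wneg_wneg_bind hA <| wneg_wneg_intro <| .or_left head

theorem wneg_wneg_or_right (hB : NSFp E Γ (wneg (wneg B))) :
    NSFp E Γ (wneg (wneg (or A B))) :=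
  wneg_wneg_bind hB <| wneg_wneg_intro <| .or_right head

/-- The axioms `∀x ¬¬E(x)` and `¬¬A → A` each cost one `⇁⇁`, and these collapse. -/
theorem wneg_wneg_exists (x : ℕ) :
    NSFp E Γ (wneg (wneg (exists_ E (FirstOrder.Language.Term.var x)))) := by
  have := all_elim (obj (E := E) (Γ := Γ) x) (freeFor_self x _)
  rw [subst_self] at this
  exact wneg_wneg_bind this (.imp_elim (.dne _) head)

/-- Introduction of an existential quantifier under double weak negation, whether or not the
quantification is global. -/
theorem wneg_wneg_ex {x : ℕ} (h : NSFp E Γ (wneg (wneg A))) :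
    NSFp E Γ (wneg (wneg (ex x A))) := by
  refine wneg_wneg_bind h (wneg_wneg_bind (wneg_wneg_exists x) (wneg_wneg_intro ?_))
  have hA : NSFp E (insert (exists_ E (FirstOrder.Language.Term.var x)) (insert A Γ))
      (A.subst x (FirstOrder.Language.Term.var x)) := by
    rw [subst_self]; exact tail head
  by_cases hg : OnlyGlobal x A
  · exact .ex_glo_intro hg (freeFor_self x A) hA
  · exact .ex_loc_intro hg (freeFor_self x A) hA head

theorem ex_elim_singleton {x : ℕ} (hx : x ∉ C.fv)
    (h : NSFp E (insert A (insert (exists_ E (FirstOrder.Language.Term.var x)) ∅)) C)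
    (hg : OnlyGlobal x A → NSFp E {A} C) : NSFp E {ex x A} C := by
  have e : NSFp E ({ex x A} ∪ ∅) C → NSFp E {ex x A} C := fun h => by
    rwa [Set.union_empty] at h
  by_cases hA : OnlyGlobal x A
  · refine e (.ex_glo_elim hA (freeFor_self x A) (.inl rfl) hx (by simp) (.hyp rfl) ?_)
    rw [subst_self]
    exact .weaken (hg hA) (by simp)
  · refine e (.ex_loc_elim hA (freeFor_self x A) (.inl rfl) hx (by simp) (.hyp rfl) ?_)
    rwa [subst_self]

theorem wneg_wneg_ex_congr {x : ℕ} (h : NSFp E {A} (wneg (wneg B))) :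
    NSFp E {ex x A} (wneg (wneg (ex x B))) :=
  ex_elim_singleton (by simp [fv]) (wneg_wneg_ex (of_singleton h head)) fun _ => wneg_wneg_ex h

/-- If `∃xA` is local, its elimination supplies `E(x)`, which serves either kind of introduction. If
it is global, no `E(x)` is available, so `∃xB` must be global too. -/
theorem ex_congr {x : ℕ} (h : NSFp E {A} B) (hAB : OnlyGlobal x A → OnlyGlobal x B) :
    NSFp E {ex x A} (ex x B) := by
  refine ex_elim_singleton (by simp [fv]) ?_ fun hA => ?_
  · have hB := of_singleton h (head (E := E) (A := A)
      (Γ := insert (exists_ E (FirstOrder.Language.Term.var x)) ∅))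
    by_cases hg : OnlyGlobal x B
    · exact .ex_glo_intro (t := .var x) hg (freeFor_self x B) (by rwa [subst_self])
    · exact .ex_loc_intro hg (freeFor_self x B) (by rwa [subst_self]) (tail head)
  · exact .ex_glo_intro (t := .var x) (hAB hA) (freeFor_self x B) (by rwa [subst_self])

end NSFp

/-! ### Replacing one weak negation inside a context -/

namespace Cont

theorem fv_fill_neg (F : Cont L) (B : Fm L) : (F.fill (Fm.neg B)).fv = (F.fill (wneg B)).fv := by
  induction F with
  | hole => simp [fill, fv]
  | _ => simp_all [fill, fv]

/-- The converse fails, for instance at the hole when `B` is not global negative. -/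
theorem isGN_fill_neg (F : Cont L) {B : Fm L} (h : IsGN (F.fill (wneg B))) :
    IsGN (F.fill (Fm.neg B)) := by
  induction F with
  | hole => exact .neg B
  | neg F => exact .neg _
  | _ =>
    simp only [fill, isGN_and_iff, isGN_or_iff, isGN_imp_iff, isGN_all_iff, isGN_ex_iff,
      fv_fill_neg] at h ⊢
    tauto

theorem occursNonglobally_fill_neg (F : Cont L) {B : Fm L} {x : ℕ}
    (h : OccursNonglobally x (F.fill (Fm.neg B))) : OccursNonglobally x (F.fill (wneg B)) := by
  have hGN := F.isGN_fill_neg (B := B)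
  induction F with
  | hole => exact (h.1 (.neg B)).elim
  | neg F => exact (h.1 (.neg _)).elim
  | _ =>
    rename_i ih
    simp only [fill, OccursNonglobally] at h hGN ⊢
    have := fun h' => ih h' (isGN_fill_neg _)
    tauto

theorem onlyGlobal_fill_neg (F : Cont L) {B : Fm L} {x : ℕ}
    (h : OnlyGlobal x (F.fill (wneg B))) : OnlyGlobal x (F.fill (Fm.neg B)) :=
  ⟨by rw [fv_fill_neg]; exact h.1, fun h' => h.2 (F.occursNonglobally_fill_neg h')⟩

theorem unneg_fill_neg (F : Cont L) (B : Fm L) :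
    (F.fill (Fm.neg B)).unneg = (F.fill (wneg B)).unneg := by
  induction F with
  | hole => rfl
  | _ => simp_all [fill, unneg]

/-- Replacing one occurrence of `⇁B` by `¬B` gives a consequence, and conversely up to double weak
negation. -/
theorem nsfp_fill_neg (F : Cont L) (B : Fm L) :
    NSFp E {F.fill (wneg B)} (F.fill (Fm.neg B)) ∧
      NSFp E {F.fill (Fm.neg B)} (wneg (wneg (F.fill (wneg B)))) := by
  have refl : ∀ A : Fm L, NSFp E {A} (wneg (wneg A)) := fun A => .wneg_wneg_intro (.hyp rfl)
  induction F with
  | hole =>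
    exact ⟨.neg_intro (.hyp rfl), .wneg_wneg_intro <| .wneg_intro <|
      .neg_elim (.tail (.hyp rfl)) .head⟩
  | andL F A ih =>
    exact ⟨.and_congr ih.1 (.hyp rfl), .wneg_wneg_and (.of_singleton ih.2 (.and_left (.hyp rfl)))
      (.wneg_wneg_intro (.and_right (.hyp rfl)))⟩
  | andR A F ih =>
    exact ⟨.and_congr (.hyp rfl) ih.1, .wneg_wneg_and (.wneg_wneg_intro (.and_left (.hyp rfl)))
      (.of_singleton ih.2 (.and_right (.hyp rfl)))⟩
  | orL F A ih =>
    exact ⟨.or_congr ih.1 (.hyp rfl), .or_elim (.hyp rfl)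
      (.wneg_wneg_or_left (.of_singleton ih.2 .head)) (.wneg_wneg_intro (.or_right .head))⟩
  | orR A F ih =>
    exact ⟨.or_congr (.hyp rfl) ih.1, .or_elim (.hyp rfl)
      (.wneg_wneg_intro (.or_left .head)) (.wneg_wneg_or_right (.of_singleton ih.2 .head))⟩
  | impL F A ih =>
    -- The antecedent is contravariant, so the two halves of the induction hypothesis exchange
    -- roles.
    exact ⟨.imp_congr ih.2 (refl A), .wneg_wneg_intro (.imp_congr (.wneg_wneg_intro ih.1) (refl A))⟩
  | impR A F ih =>
    exact ⟨.imp_congr (refl A) (.wneg_wneg_intro ih.1), .wneg_wneg_intro (.imp_congr (refl A) ih.2)⟩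
  | neg F ih =>
    exact ⟨.neg_congr ih.2, .wneg_wneg_intro (.neg_congr (.wneg_wneg_intro ih.1))⟩
  | all x F ih =>
    exact ⟨.all_congr (.wneg_wneg_intro ih.1), .wneg_wneg_intro (.all_congr ih.2)⟩
  | ex x F ih =>
    -- Forwards, a global quantifier stays global. Backwards, it may become local, and the `E(x)`
    -- then needed is available only under `⇁⇁`.
    exact ⟨.ex_congr ih.1 F.onlyGlobal_fill_neg, .wneg_wneg_ex_congr ih.2⟩

end Cont

/-! ### Iterates of `Ψ` and the separating formula -/

theorem psiImage_subset_SFQp {X : Set (Fm L)} (h : X ⊆ SFQp E) : PsiImage X ⊆ SFQp E := by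
  intro C hC
  simp only [PsiImage, Set.mem_iUnion] at hC
  obtain ⟨A, hA, F, B, rfl, rfl⟩ := hC
  obtain ⟨hcl, hd⟩ := h hA
  exact ⟨by rw [Closed, Cont.fv_fill_neg]; exact hcl, .of_singleton (F.nsfp_fill_neg B).1 hd⟩

theorem iterate_psiImage_subset_SFQp (n : ℕ) :
    PsiImage^[n] (SFQpNegFree E) ⊆ SFQp E := by
  induction n with
  | zero => exact fun A hA => hA.1
  | succ n ih => rw [Function.iterate_succ_apply']; exact psiImage_subset_SFQp ih

theorem unneg_mem_of_mem_iterate_psiImage {n : ℕ} {A : Fm L}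
    (h : A ∈ PsiImage^[n] (SFQpNegFree E)) : A.unneg ∈ SFQp E := by
  induction n generalizing A with
  | zero =>
    have h' : A ∈ SFQpNegFree E := h
    rw [h'.2.unneg_eq]
    exact h'.1
  | succ n ih =>
    rw [Function.iterate_succ_apply'] at h
    simp only [PsiImage, Set.mem_iUnion] at h
    obtain ⟨A', hA', F, B, rfl, rfl⟩ := h
    rw [Cont.unneg_fill_neg]
    exact ih hA'

theorem ex_neg_imp_neg_mem_SFQp {P : Fm L} {x : ℕ} (hP : P.fv = {x}) :
    ex x (imp (neg P) (neg P)) ∈ SFQp E := by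
  refine ⟨by simp [Closed, fv, hP], ?_⟩
  refine .ex_glo_intro (t := .var x)
    ⟨by simp [fv, hP], (IsGN.imp (.neg P) (.neg P)).not_occursNonglobally x⟩ (freeFor_self x _) ?_
  rw [subst_self]
  exact .imp_intro (.wneg_wneg_intro .head)

theorem ex_wneg_imp_wneg_notMem_SFQp {n : ℕ} {R : L.Relations n} {ts : Fin n → L.Term ℕ} {x : ℕ}
    (hP : (atom R ts).fv = {x}) :
    ex x (imp (wneg (atom R ts)) (wneg (atom R ts))) ∉ SFQp E := by
  intro h
  -- Forcing at the root would make the quantifier global, but `P` is an atom, so neither `⇁P` nor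
  -- the implication is global negative.
  refine (h.2.forceRoot (by simp)).1.2 ?_
  have : x ∈ (atom R ts).fv := by simp [hP]
  simp [OccursNonglobally, isGN_imp_iff, not_isGN_atom, this]

end Derivations

end SFQ

theorem mainTheorem11 (L : FirstOrder.Language.{u, v}) (E : L.Relations 1) :
    (⋃ n : ℕ, SFQ.PsiImage^[n] (SFQ.SFQpNegFree E)) ⊂ SFQ.SFQp E ∧
    ∀ (x n : ℕ) (R : L.Relations n) (ts : Fin n → L.Term ℕ) (P : SFQ.Fm L),
      P = SFQ.Fm.atom R ts → P.fv = {x} →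
        SFQ.Fm.ex x (SFQ.Fm.imp (SFQ.Fm.neg P) (SFQ.Fm.neg P)) ∈ SFQ.SFQp E ∧
        SFQ.Fm.ex x (SFQ.Fm.imp (SFQ.Fm.wneg P) (SFQ.Fm.wneg P)) ∉ SFQ.SFQp E ∧
        SFQ.Fm.ex x (SFQ.Fm.imp (SFQ.Fm.neg P) (SFQ.Fm.neg P)) ∉
          ⋃ n : ℕ, SFQ.PsiImage^[n] (SFQ.SFQpNegFree E) := by
  have key : ∀ {x n : ℕ} {R : L.Relations n} {ts : Fin n → L.Term ℕ},
      (SFQ.Fm.atom R ts).fv = {x} →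
      SFQ.Fm.ex x (SFQ.Fm.imp (SFQ.Fm.neg (SFQ.Fm.atom R ts)) (SFQ.Fm.neg (SFQ.Fm.atom R ts))) ∉
        ⋃ n : ℕ, SFQ.PsiImage^[n] (SFQ.SFQpNegFree E) := by
    intro x n R ts hP h
    obtain ⟨m, hm⟩ := Set.mem_iUnion.1 h
    -- `unneg` of the formula unfolds definitionally to its `⇁` version.
    exact SFQ.ex_wneg_imp_wneg_notMem_SFQp hP (SFQ.unneg_mem_of_mem_iterate_psiImage hm)
  refine ⟨⟨Set.iUnion_subset SFQ.iterate_psiImage_subset_SFQp, fun h => ?_⟩, ?_⟩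
  -- `E(v₀)` is an atomic formula of the required kind in every language considered.
  · have hP : (SFQ.Fm.atom E fun _ => FirstOrder.Language.Term.var 0).fv = {0} := by
      simp [SFQ.Fm.fv, FirstOrder.Language.Term.varFinset]
    exact key hP (h (SFQ.ex_neg_imp_neg_mem_SFQp hP))
  · rintro x n R ts P rfl hP
    exact ⟨SFQ.ex_neg_imp_neg_mem_SFQp hP, SFQ.ex_wneg_imp_wneg_notMem_SFQp hP, key hP⟩
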